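/- For a triangle $T\subset\mathbb R^2$ (nondegenerate, closed) let $|T|$ be its area, and let $\mathcal P_1$ be the set of polynomials $ax+by+c$ with $a,b,c\in\mathbb R$. For $1\le p\le\infty$, $0<\alpha,\beta<\infty$ and a continuous function $f$ on $T$ put $$\|f\|_{L_{p;\alpha,\beta}(T)}=\|\alpha f_++\beta f_-\|_{L_p(T)},\qquad f_\pm=\max\{\pm f,0\},\qquad E(f;\mathcal P_1)_{L_{p;\alpha,\beta}(T)}=\inf_{u\in\mathcal P_1}\|f-u\|_{L_{p;\alpha,\beta}(T)} .$$ One of $\alpha,\beta$ (not both) may also be $+\infty$, and then $E$ is the error of one-sided approximation: for $\beta=\infty$ the infimum is over those $u\in\mathcal P_1$ with $u\le f$ on $T$, and for $\alpha=\infty$ over those with $u\ge f$ on $T$, the part of $f-u$ with the infinite weight being zero and contributing nothing to the norm. With $q(x,y)=x^2+y^2$ let $$C_{p;\alpha,\beta}=\inf_T\frac{E(q;\mathcal P_1)_{L_{p;\alpha,\beta}(T)}}{|T|^{1+1/p}},$$ the infimum being over all triangles $T$ in $\mathbb R^2$ (and $1/p=0$ for $p=\infty$). **Corollary.** Let $Q(x,y)=Ax^2+By^2+2Cxy$,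 with $A,B,C\in\mathbb R$, be a positive definite quadratic form (so $A>0$ and $AB-C^2>0$). Then for all $\alpha,\beta\in(0,\infty]$, not both infinite, and all $1\le p\le\infty$, $$\inf_T\frac{E(Q;\mathcal P_1)_{L_{p;\alpha,\beta}(T)}}{|T|^{1+1/p}}=C_{p;\alpha,\beta}\sqrt{AB-C^2}=E(q;\mathcal P_1)_{L_{p;\alpha,\beta}(T_0)}\sqrt{AB-C^2},$$ where the infimum is over all triangles $T$ in $\mathbb R^2$ and $T_0$ is any equilateral triangle of unit area. -/

import Mathlib

open scoped ENNReal

noncomputable section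

namespace AsymApprox

/-- The Euclidean plane. -/
abbrev Plane : Type := EuclideanSpace ℝ (Fin 2)

/-- Nondegenerate triangles in the plane (three affinely independent vertices). -/
abbrev PlaneTriangle : Type := Affine.Triangle ℝ Plane

/-- The closed triangular region spanned by the vertices of `T`. -/
def region (T : PlaneTriangle) : Set Plane := convexHull ℝ (Set.range T.points)

/-- The area `|T|` (two-dimensional Lebesgue measure); it is positive and finite. -/
def area (T : PlaneTriangle) : ℝ≥0∞ := MeasureTheory.volume (region T)

/-- The bivariate linear polynomials `a x + b y + c`, as functions on the plane. -/
def linearPolys : Set (Plane → ℝ) :=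
  {u | ∃ a b c : ℝ, ∀ z : Plane, u z = a * z 0 + b * z 1 + c}

/-- The asymmetric norm `‖α f₊ + β f₋‖` in `L_p(K)`, as a number in `[0, ∞]`. Here
`ENNReal.ofReal (f z) = max (f z) 0` is the positive part and `ENNReal.ofReal (-f z)` the
negative part of `f`; an infinite weight multiplies a zero part to zero. -/
def asymNorm (p α β : ℝ≥0∞) (K : Set Plane) (f : Plane → ℝ) : ℝ≥0∞ :=
  MeasureTheory.eLpNorm
    (fun z => α * ENNReal.ofReal (f z) + β * ENNReal.ofReal (-f z)) p
    (MeasureTheory.volume.restrict K)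

/-- The polynomials admitted in best `(α, β)`-approximation of `f` on `K`. For finite `α`, `β`
these are all linear polynomials. If `α = ∞`, only those with `u ≥ f` on `K` are admitted
(approximation from above); if `β = ∞`, only those with `u ≤ f` on `K` (approximation from
below). -/
def admissible (α β : ℝ≥0∞) (K : Set Plane) (f : Plane → ℝ) : Set (Plane → ℝ) :=
  {u | u ∈ linearPolys ∧ (α = ∞ → ∀ z ∈ K, f z ≤ u z) ∧ (β = ∞ → ∀ z ∈ K, u z ≤ f z)}

/-- The error `E(f; P₁)` of best `(α, β)`-approximation of `f` in `L_p(K)` by linear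
polynomials. -/
def bestError (p α β : ℝ≥0∞) (K : Set Plane) (f : Plane → ℝ) : ℝ≥0∞ :=
  ⨅ u ∈ admissible α β K f, asymNorm p α β K (fun z => f z - u z)

/-- The infimum over all triangles `T` of `E(f; P₁) / |T| ^ (1 + 1 / p)`, where `1 / ∞ = 0`. -/
def infRatio (p α β : ℝ≥0∞) (f : Plane → ℝ) : ℝ≥0∞ :=
  ⨅ T : PlaneTriangle, bestError p α β (region T) f / area T ^ (1 + p⁻¹).toReal

/-- The quadratic form `A x² + B y² + 2 C x y`. -/
def quadForm (A B C : ℝ) (z : Plane) : ℝ := A * z 0 ^ 2 + B * z 1 ^ 2 + 2 * C * z 0 * z 1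

/-- The quadratic form `x² + y²`. -/
def sqForm (z : Plane) : ℝ := z 0 ^ 2 + z 1 ^ 2

/-- The constant `C_{p;α,β}`: the infimum above for `x² + y²`. -/
def bestConst (p α β : ℝ≥0∞) : ℝ≥0∞ := infRatio p α β sqForm

end AsymApprox

end

/-!
An affine change of coordinates carries the problem for a triangle `T` to a fixed reference
triangle: if `T` has edge vectors `m`, `n` from one vertex, then modulo linear polynomials `Q`
becomes the form with coefficients `a = Q(m)`, `b = Q(n)` and `c` the polar form of `Q` at `m`, `n`,
and the ratio `E / |T| ^ (1 + 1 / p)` becomes, up to a constant depending only on `p`, the error of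
that form on the reference triangle divided by `|det (m, n)|` (`ratio_eq`).

The error `E` is sublinear in the function (`bestError_add_le`, `bestError_const_mul`), including
the one-sided cases, and it is invariant under the affine map permuting the vertices of the
reference triangle cyclically. Averaging a quadratic form over the three such rotations gives
`2 / 3 * (a + b - c)` times the form `x² + y² + x y`, and averaging cannot increase the error
(`le_bestError_refTriangle`). Here `2 * (a + b - c)` is the sum of the values of `Q` on the three
edges of `T`, so Weitzenböck's inequality bounds it below by `√12 * √(A B - C²) * |det (m, n)|`
(`extremalRatio_le`). Both inequalities are equalities when `Q` takes equal values on the three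
edges (`ratio_eq_extremalRatio`). Such a triangle exists for every positive definite `Q`, and for
`x² + y²` these are the equilateral triangles.
-/

noncomputable section
namespace AsymApprox

open MeasureTheory

/-! ### Sublinearity of the error of best approximation -/

lemma linearPolys_add {u v : Plane → ℝ} (hu : u ∈ linearPolys) (hv : v ∈ linearPolys) :
    (fun z => u z + v z) ∈ linearPolys := by
  obtain ⟨a, b, c, hu⟩ := hu
  obtain ⟨a', b', c', hv⟩ := hv
  exact ⟨a + a', b + b', c + c', fun z => by simp only [hu, hv]; ring⟩

lemma linearPolys_const_mul {u : Plane → ℝ} (hu : u ∈ linearPolys) (t : ℝ) :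
    (fun z => t * u z) ∈ linearPolys := by
  obtain ⟨a, b, c, hu⟩ := hu
  exact ⟨t * a, t * b, t * c, fun z => by simp only [hu]; ring⟩

lemma continuous_of_mem_linearPolys {u : Plane → ℝ} (hu : u ∈ linearPolys) : Continuous u := by
  obtain ⟨a, b, c, hu⟩ := hu
  rw [funext hu]
  fun_prop

variable {p α β : ℝ≥0∞} {K : Set Plane} {f g u : Plane → ℝ}

lemma asymNorm_add_le (hp : 1 ≤ p) (hf : Continuous f) (hg : Continuous g) :
    asymNorm p α β K (fun z => f z + g z) ≤ asymNorm p α β K f + asymNorm p α β K g := by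
  have meas : ∀ h : Plane → ℝ, Continuous h → AEStronglyMeasurable
      (fun z => α * ENNReal.ofReal (h z) + β * ENNReal.ofReal (-h z)) (volume.restrict K) := by
    intro h hh
    have := hh.measurable
    exact Measurable.aestronglyMeasurable (by fun_prop)
  refine le_trans (eLpNorm_mono_enorm fun z => ?_) (eLpNorm_add_le (meas f hf) (meas g hg) hp)
  simp only [enorm_eq_self, Pi.add_apply]
  calc α * ENNReal.ofReal (f z + g z) + β * ENNReal.ofReal (-(f z + g z))
      ≤ α * (ENNReal.ofReal (f z) + ENNReal.ofReal (g z))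
        + β * (ENNReal.ofReal (-f z) + ENNReal.ofReal (-g z)) := by
        gcongr
        · exact ENNReal.ofReal_add_le
        · rw [neg_add]; exact ENNReal.ofReal_add_le
    _ = _ := by ring

lemma bestError_add_le (hp : 1 ≤ p) (hf : Continuous f) (hg : Continuous g) :
    bestError p α β K (fun z => f z + g z) ≤ bestError p α β K f + bestError p α β K g := by
  simp only [bestError]
  refine ENNReal.le_iInf₂_add_iInf₂ fun u hu v hv => ?_
  refine (iInf₂_le (fun z => u z + v z) ⟨linearPolys_add hu.1 hv.1,
    fun h z hz => add_le_add (hu.2.1 h z hz) (hv.2.1 h z hz),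
    fun h z hz => add_le_add (hu.2.2 h z hz) (hv.2.2 h z hz)⟩).trans ?_
  have := asymNorm_add_le (α := α) (β := β) (K := K) hp
    (hf.sub (continuous_of_mem_linearPolys hu.1)) (hg.sub (continuous_of_mem_linearPolys hv.1))
  refine le_of_eq_of_le (congrArg _ (funext fun z => ?_)) this
  simp only [Pi.sub_apply]
  ring

/-- One half of the homogeneity; the converse follows by scaling back with `t⁻¹`. -/
lemma bestError_const_mul_le {t : ℝ} (ht : 0 < t) :
    bestError p α β K (fun z => t * f z) ≤ ENNReal.ofReal t * bestError p α β K f := by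
  simp only [bestError]
  rw [ENNReal.mul_iInf_of_ne (by simpa using ht) ENNReal.ofReal_ne_top]
  simp only [ENNReal.mul_iInf_of_ne (a := ENNReal.ofReal t) (by simpa using ht)
    ENNReal.ofReal_ne_top]
  refine le_iInf₂ fun u hu => ?_
  refine (iInf₂_le (fun z => t * u z) ⟨linearPolys_const_mul hu.1 t,
    fun h z hz => mul_le_mul_of_nonneg_left (hu.2.1 h z hz) ht.le,
    fun h z hz => mul_le_mul_of_nonneg_left (hu.2.2 h z hz) ht.le⟩).trans ?_
  refine eLpNorm_le_mul_eLpNorm_of_ae_le_mul' (c := t.toNNReal) (ae_of_all _ fun z => ?_) p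
  simp only [enorm_eq_self]
  rw [← mul_sub, ← mul_neg, ENNReal.ofReal_mul ht.le, ENNReal.ofReal_mul ht.le, ENNReal.ofReal]
  exact le_of_eq (by ring)

lemma bestError_const_mul {t : ℝ} (ht : 0 < t) :
    bestError p α β K (fun z => t * f z) = ENNReal.ofReal t * bestError p α β K f := by
  refine le_antisymm (bestError_const_mul_le ht) ?_
  have h := bestError_const_mul_le (p := p) (α := α) (β := β) (K := K)
    (f := fun z => t * f z) (inv_pos.2 ht)
  simp only [inv_mul_cancel_left₀ ht.ne'] at h
  calc _ ≤ ENNReal.ofReal t * (ENNReal.ofReal t⁻¹ * bestError p α β K (fun z => t * f z)) := by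
        gcongr
    _ = _ := by rw [← mul_assoc, ← ENNReal.ofReal_mul ht.le, mul_inv_cancel₀ ht.ne']; simp

lemma bestError_add_linear_le (hu : u ∈ linearPolys) :
    bestError p α β K (fun z => f z + u z) ≤ bestError p α β K f := by
  refine le_iInf₂ fun v hv => ?_
  refine (iInf₂_le (fun z => v z + u z) ⟨linearPolys_add hv.1 hu,
    fun h z hz => add_le_add_left (hv.2.1 h z hz) _,
    fun h z hz => add_le_add_left (hv.2.2 h z hz) _⟩).trans ?_
  simp only [add_sub_add_right_eq_sub, le_refl]

/-- The error depends on `f` only modulo linear polynomials. -/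
lemma bestError_add_linear (hu : u ∈ linearPolys) :
    bestError p α β K (fun z => f z + u z) = bestError p α β K f := by
  refine le_antisymm (bestError_add_linear_le hu) ?_
  have h := bestError_add_linear_le (p := p) (α := α) (β := β) (K := K)
    (f := fun z => f z + u z) (linearPolys_const_mul hu (-1))
  refine le_of_eq_of_le (congrArg _ (funext fun z => ?_)) h
  ring

/-! ### Affine changes of variables -/

lemma linearPolys_comp (φ : Plane →ᵃ[ℝ] Plane) (hu : u ∈ linearPolys) :
    (fun z => u (φ z)) ∈ linearPolys := by
  obtain ⟨a, b, c, hu⟩ := hu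
  have hφ : ∀ z i, φ z i = z 0 * φ.linear (EuclideanSpace.single 0 1) i
      + z 1 * φ.linear (EuclideanSpace.single 1 1) i + φ 0 i := by
    intro z i
    have hz : z = z 0 • EuclideanSpace.single (0 : Fin 2) (1 : ℝ)
        + z 1 • EuclideanSpace.single (1 : Fin 2) (1 : ℝ) := by
      ext j; fin_cases j <;> simp
    calc φ z i = φ.linear z i + φ 0 i := by rw [φ.decomp]; simp
      _ = _ := by
        conv_lhs => rw [hz, map_add, map_smul, map_smul]
        simp only [PiLp.add_apply, PiLp.smul_apply, smul_eq_mul]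
  refine ⟨a * φ.linear (EuclideanSpace.single 0 1) 0 + b * φ.linear (EuclideanSpace.single 0 1) 1,
    a * φ.linear (EuclideanSpace.single 1 1) 0 + b * φ.linear (EuclideanSpace.single 1 1) 1,
    a * φ 0 0 + b * φ 0 1 + c, fun z => ?_⟩
  simp only [hu]
  rw [hφ z 0, hφ z 1]
  ring

lemma volume_eq_smul_map (φ : Plane ≃ᵃ[ℝ] Plane) :
    (volume : Measure Plane)
      = ENNReal.ofReal |LinearMap.det (φ.linear : Plane →ₗ[ℝ] Plane)| • volume.map φ := by
  have hd : LinearMap.det (φ.linear : Plane →ₗ[ℝ] Plane) ≠ 0 := φ.linear.isUnit_det'.ne_zero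
  have hφ : ⇑φ = (fun z => z + φ 0) ∘ (φ.linear : Plane →ₗ[ℝ] Plane) := by
    ext1 z
    exact congrFun (φ : Plane →ᵃ[ℝ] Plane).decomp z
  rw [hφ, ← Measure.map_map (by fun_prop)
    (LinearMap.continuous_of_finiteDimensional _).measurable,
    Measure.map_linearMap_addHaar_eq_smul_addHaar _ hd, Measure.map_smul, map_add_right_eq_self,
    smul_smul, ← ENNReal.ofReal_mul (abs_nonneg _), ← abs_mul, mul_inv_cancel₀ hd]
  simp

lemma measurableEmbedding_affineEquiv (φ : Plane ≃ᵃ[ℝ] Plane) : MeasurableEmbedding φ :=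
  (AffineEquiv.toContinuousAffineEquiv φ).toHomeomorph.measurableEmbedding

lemma volume_image (φ : Plane ≃ᵃ[ℝ] Plane) (K : Set Plane) :
    volume (φ '' K)
      = ENNReal.ofReal |LinearMap.det (φ.linear : Plane →ₗ[ℝ] Plane)| * volume K := by
  conv_lhs => rw [volume_eq_smul_map φ]
  rw [Measure.smul_apply, (measurableEmbedding_affineEquiv φ).map_apply,
    Set.preimage_image_eq _ φ.injective, smul_eq_mul]

lemma asymNorm_image (φ : Plane ≃ᵃ[ℝ] Plane) :
    asymNorm p α β (φ '' K) f
      = ENNReal.ofReal |LinearMap.det (φ.linear : Plane →ₗ[ℝ] Plane)| ^ (p⁻¹).toReal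
        * asymNorm p α β K (fun z => f (φ z)) := by
  have hd : LinearMap.det (φ.linear : Plane →ₗ[ℝ] Plane) ≠ 0 := φ.linear.isUnit_det'.ne_zero
  have h : (volume : Measure Plane).restrict (φ '' K)
      = ENNReal.ofReal |LinearMap.det (φ.linear : Plane →ₗ[ℝ] Plane)|
        • (volume.restrict K).map φ := by
    conv_lhs => rw [volume_eq_smul_map φ]
    rw [Measure.restrict_smul, (measurableEmbedding_affineEquiv φ).restrict_map,
      Set.preimage_image_eq _ φ.injective]
  rw [asymNorm, h, eLpNorm_smul_measure_of_ne_zero (by simpa using hd),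
    (measurableEmbedding_affineEquiv φ).eLpNorm_map_measure, one_div, smul_eq_mul]
  rfl

lemma bestError_image (φ : Plane ≃ᵃ[ℝ] Plane) :
    bestError p α β (φ '' K) f
      = ENNReal.ofReal |LinearMap.det (φ.linear : Plane →ₗ[ℝ] Plane)| ^ (p⁻¹).toReal
        * bestError p α β K (fun z => f (φ z)) := by
  have hd : ENNReal.ofReal |LinearMap.det (φ.linear : Plane →ₗ[ℝ] Plane)| ≠ 0 := by
    simpa using φ.linear.isUnit_det'.ne_zero
  have h0 := (ENNReal.rpow_pos_of_nonneg (pos_iff_ne_zero.2 hd)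
    (ENNReal.toReal_nonneg (a := p⁻¹))).ne'
  have h1 := ENNReal.rpow_ne_top_of_nonneg (ENNReal.toReal_nonneg (a := p⁻¹))
    (ENNReal.ofReal_ne_top (r := |LinearMap.det (φ.linear : Plane →ₗ[ℝ] Plane)|))
  simp only [bestError, ENNReal.mul_iInf_of_ne h0 h1]
  refine le_antisymm (le_iInf₂ fun v hv => ?_) (le_iInf₂ fun u hu => ?_)
  · have hadm : (fun z => v (φ.symm z)) ∈ admissible α β (φ '' K) f := by
      refine ⟨linearPolys_comp φ.symm hv.1, ?_, ?_⟩
      · rintro h _ ⟨z, hz, rfl⟩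
        simpa using hv.2.1 h z hz
      · rintro h _ ⟨z, hz, rfl⟩
        simpa using hv.2.2 h z hz
    refine (iInf₂_le _ hadm).trans ?_
    rw [asymNorm_image]
    simp
  · refine (iInf₂_le (fun z => u (φ z)) ⟨linearPolys_comp φ hu.1,
      fun h z hz => hu.2.1 h _ ⟨z, hz, rfl⟩, fun h z hz => hu.2.2 h _ ⟨z, hz, rfl⟩⟩).trans ?_
    rw [asymNorm_image]


/-! ### Frames and the reference triangle -/

/-- The determinant of the pair of vectors `m`, `n`. -/
def cross (m n : Plane) : ℝ := m 0 * n 1 - m 1 * n 0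

/-- The symmetric bilinear form whose quadratic form is `quadForm A B C`. -/
def bilinForm (A B C : ℝ) (m n : Plane) : ℝ :=
  A * m 0 * n 0 + B * m 1 * n 1 + C * (m 0 * n 1 + m 1 * n 0)

/-- The linear map with columns `m`, `n`. -/
def frameLin (m n : Plane) : Plane →ₗ[ℝ] Plane :=
  Matrix.toLpLin 2 2 !![m 0, n 0; m 1, n 1]

lemma frameLin_apply (m n z : Plane) : frameLin m n z = z 0 • m + z 1 • n := by
  ext i
  fin_cases i <;> simp [frameLin, Matrix.toLpLin_apply, dotProduct] <;> ring

lemma det_frameLin (m n : Plane) : LinearMap.det (frameLin m n) = cross m n := by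
  rw [frameLin, Matrix.toLpLin_eq_toLin, LinearMap.det_toLin, Matrix.det_fin_two_of, cross]
  ring

/-- The affine change of coordinates `z ↦ P + z₀ m + z₁ n`. -/
def frame (P m n : Plane) (h : cross m n ≠ 0) : Plane ≃ᵃ[ℝ] Plane :=
  (LinearMap.equivOfIsUnitDet (f := frameLin m n)
    (by rw [det_frameLin]; exact h.isUnit)).toAffineEquiv.trans (AffineEquiv.constVAdd ℝ Plane P)

lemma frame_apply (P m n : Plane) (h : cross m n ≠ 0) (z : Plane) :
    frame P m n h z = P + (z 0 • m + z 1 • n) := by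
  rw [← frameLin_apply]
  simp [frame]

lemma det_frame (P m n : Plane) (h : cross m n ≠ 0) :
    LinearMap.det ((frame P m n h).linear : Plane →ₗ[ℝ] Plane) = cross m n := by
  rw [← det_frameLin]
  exact congrArg LinearMap.det (LinearMap.coe_equivOfIsUnitDet
    (by rw [det_frameLin]; exact h.isUnit))

/-- The reference triangle with vertices `(0, 0)`, `(1, 0)`, `(0, 1)`. -/
def refTriangle : Set Plane := convexHull ℝ {!₂[0, 0], !₂[1, 0], !₂[0, 1]}

lemma frame_image_refTriangle (P m n : Plane) (h : cross m n ≠ 0) :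
    frame P m n h '' refTriangle = convexHull ℝ {P, P + m, P + n} := by
  have := AffineMap.image_convexHull (frame P m n h : Plane →ᵃ[ℝ] Plane)
    {!₂[0, 0], !₂[1, 0], !₂[0, 1]}
  refine this.trans ?_
  simp [Set.image_insert_eq, frame_apply]

/-- In frame coordinates a quadratic form keeps its shape up to a linear polynomial. -/
lemma quadForm_frame (A B C : ℝ) (P m n : Plane) (h : cross m n ≠ 0) :
    ∃ u ∈ linearPolys, ∀ z, quadForm A B C (frame P m n h z)
      = quadForm (quadForm A B C m) (quadForm A B C n) (bilinForm A B C m n) z + u z := by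
  refine ⟨fun z => 2 * bilinForm A B C P m * z 0 + 2 * bilinForm A B C P n * z 1
    + quadForm A B C P, ⟨_, _, _, fun z => rfl⟩, fun z => ?_⟩
  simp only [frame_apply, quadForm, bilinForm, PiLp.add_apply, PiLp.smul_apply, smul_eq_mul]
  ring

lemma bestError_frame_image (A B C : ℝ) (P m n : Plane) (h : cross m n ≠ 0) :
    bestError p α β (convexHull ℝ {P, P + m, P + n}) (quadForm A B C)
      = ENNReal.ofReal |cross m n| ^ (p⁻¹).toReal * bestError p α β refTriangle
        (quadForm (quadForm A B C m) (quadForm A B C n) (bilinForm A B C m n)) := by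
  obtain ⟨u, hu, hQ⟩ := quadForm_frame A B C P m n h
  rw [← frame_image_refTriangle P m n h, bestError_image, det_frame]
  simp only [hQ]
  rw [bestError_add_linear hu]

/-! ### Averaging over the rotations of the reference triangle -/

/-- Invariance under the affine map permuting the vertices of the reference triangle cyclically. -/
lemma bestError_refTriangle_rotate (a b c : ℝ) :
    bestError p α β refTriangle (quadForm a b c)
      = bestError p α β refTriangle (quadForm b (a + b - 2 * c) (b - c)) := by
  have hd : cross !₂[0, -1] !₂[1, -1] = 1 := by simp [cross]
  have h := bestError_frame_image (p := p) (α := α) (β := β) a b c !₂[0, 1] !₂[0, -1] !₂[1, -1]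
    (by simp [hd])
  have hK : convexHull ℝ {!₂[0, 1], !₂[0, 1] + !₂[0, -1], !₂[0, 1] + !₂[1, -1]}
      = refTriangle := by
    have h1 : (!₂[0, 1] + !₂[0, -1] : Plane) = !₂[0, 0] := by
      ext i; fin_cases i <;> simp
    have h2 : (!₂[0, 1] + !₂[1, -1] : Plane) = !₂[1, 0] := by
      ext i; fin_cases i <;> simp
    rw [h1, h2, refTriangle]
    congr 1
    ext z
    simp only [Set.mem_insert_iff, Set.mem_singleton_iff]
    tauto
  rw [hK, hd] at h
  rw [h]
  simp only [abs_one, ENNReal.ofReal_one, ENNReal.one_rpow, one_mul]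
  congr 2 <;> simp [quadForm, bilinForm] <;> ring

lemma continuous_quadForm (a b c : ℝ) : Continuous (quadForm a b c) := by
  unfold quadForm
  fun_prop

/-- The average of a quadratic form over the three rotations of the reference triangle is a
multiple of `x² + y² + x y`, the form all of whose values on the edges are `1`; by sublinearity
averaging does not increase the error. -/
lemma le_bestError_refTriangle (hp : 1 ≤ p) {a b c : ℝ} (h : 0 < a + b - c) :
    ENNReal.ofReal (2 / 3 * (a + b - c)) * bestError p α β refTriangle (quadForm 1 1 (1 / 2))
      ≤ bestError p α β refTriangle (quadForm a b c) := by
  have e1 := bestError_refTriangle_rotate (p := p) (α := α) (β := β) a b c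
  have e2 := bestError_refTriangle_rotate (p := p) (α := α) (β := β) b (a + b - 2 * c) (b - c)
  rw [show b + (a + b - 2 * c) - 2 * (b - c) = a by ring,
    show a + b - 2 * c - (b - c) = a - c by ring] at e2
  have hsum : (fun z => (quadForm a b c z + quadForm b (a + b - 2 * c) (b - c) z)
      + quadForm (a + b - 2 * c) a (a - c) z)
      = fun z => 3 * (2 / 3 * (a + b - c) * quadForm 1 1 (1 / 2) z) := by
    ext z
    simp only [quadForm]
    ring
  have hle := (bestError_add_le (α := α) (β := β) (K := refTriangle) hp
    ((continuous_quadForm a b c).add (continuous_quadForm b (a + b - 2 * c) (b - c)))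
    (continuous_quadForm (a + b - 2 * c) a (a - c))).trans
    (add_le_add_left (bestError_add_le hp (continuous_quadForm _ _ _)
      (continuous_quadForm _ _ _)) _)
  rw [← e2, ← e1] at hle
  simp only [Pi.add_apply] at hle
  rw [hsum, bestError_const_mul three_pos, bestError_const_mul (by positivity)] at hle
  have h3 : ENNReal.ofReal 3 = 3 := by simp
  rw [h3] at hle
  refine (ENNReal.mul_le_mul_iff_right (a := 3) (by simp) (by simp)).1 (hle.trans_eq ?_)
  ring

/-! ### Triangles in the plane -/

lemma cross_ne_zero (T : PlaneTriangle) :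
    cross (T.points 1 - T.points 0) (T.points 2 - T.points 0) ≠ 0 := by
  intro h
  have hT : AffineIndependent ℝ (T.points : Fin 3 → Plane) := T.independent
  rw [affineIndependent_iff] at hT
  have key : ∀ s t : ℝ, s • (T.points 1 - T.points 0) + t • (T.points 2 - T.points 0) = 0 →
      s = 0 ∧ t = 0 := by
    intro s t hst
    have hw := hT Finset.univ ![-(s + t), s, t] (by simp [Fin.sum_univ_three])
      (by
        refine (Fin.sum_univ_three _).trans (Eq.trans ?_ hst)
        simp only [Matrix.cons_val]
        module)
    exact ⟨by simpa using hw 1 (Finset.mem_univ _), by simpa using hw 2 (Finset.mem_univ _)⟩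
  generalize T.points 1 - T.points 0 = m at h key
  generalize T.points 2 - T.points 0 = n at h key
  rw [cross] at h
  have h1 := key (n 1) (-m 1) (by ext i; fin_cases i <;> simp <;> linarith)
  have h0 := key (n 0) (-m 0) (by ext i; fin_cases i <;> simp <;> linarith)
  have := key 1 0 (by
    ext i
    fin_cases i <;> simp
    · linarith
    · linarith)
  exact one_ne_zero this.1

/-- Every frame spans a nondegenerate triangle. -/
lemma exists_triangle_of_cross_ne_zero (m n : Plane) (h : cross m n ≠ 0) :
    ∃ T : PlaneTriangle, T.points 0 = 0 ∧ T.points 1 = m ∧ T.points 2 = n := by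
  suffices hT : AffineIndependent ℝ (![0, m, n] : Fin 3 → Plane) from ⟨⟨_, hT⟩, rfl, rfl, rfl⟩
  rw [affineIndependent_iff_of_fintype]
  intro w hw hs
  rw [Finset.weightedVSub_eq_weightedVSubOfPoint_of_sum_eq_zero _ _ _ hw (0 : Plane)] at hs
  simp only [Finset.weightedVSubOfPoint_apply, Fin.sum_univ_three, Matrix.cons_val] at hs hw
  have g0 : w 1 * m 0 + w 2 * n 0 = 0 := by simpa using congrArg (fun z : Plane => z 0) hs
  have g1 : w 1 * m 1 + w 2 * n 1 = 0 := by simpa using congrArg (fun z : Plane => z 1) hs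
  have hw1 : w 1 = 0 := by
    refine (mul_eq_zero.1 (?_ : w 1 * cross m n = 0)).resolve_right h
    rw [cross]; linear_combination n 1 * g0 - n 0 * g1
  have hw2 : w 2 = 0 := by
    refine (mul_eq_zero.1 (?_ : w 2 * cross m n = 0)).resolve_right h
    rw [cross]; linear_combination m 0 * g1 - m 1 * g0
  intro i
  fin_cases i
  · simp; linarith
  · exact hw1
  · exact hw2

lemma region_eq (T : PlaneTriangle) :
    region T = convexHull ℝ {T.points 0, T.points 0 + (T.points 1 - T.points 0),
      T.points 0 + (T.points 2 - T.points 0)} := by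
  rw [region]
  congr 1
  ext z
  simp [Fin.exists_fin_succ, eq_comm]

lemma area_eq (T : PlaneTriangle) :
    area T = ENNReal.ofReal |cross (T.points 1 - T.points 0) (T.points 2 - T.points 0)|
      * volume refTriangle := by
  rw [area, region_eq, ← frame_image_refTriangle _ _ _ (cross_ne_zero T), volume_image, det_frame]

/-- The ratio for a triangle, transported to the reference triangle. -/
lemma ratio_eq (hp : 1 ≤ p) (A B C : ℝ) (T : PlaneTriangle) {m n : Plane}
    (hm : m = T.points 1 - T.points 0) (hn : n = T.points 2 - T.points 0) :
    bestError p α β (region T) (quadForm A B C) / area T ^ (1 + p⁻¹).toReal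
      = ENNReal.ofReal |cross m n|⁻¹ * (bestError p α β refTriangle
          (quadForm (quadForm A B C m) (quadForm A B C n) (bilinForm A B C m n))
        / volume refTriangle ^ (1 + p⁻¹).toReal) := by
  have hd : cross m n ≠ 0 := by rw [hm, hn]; exact cross_ne_zero T
  rw [region_eq, area_eq, ← hm, ← hn, bestError_frame_image _ _ _ _ _ _ hd,
    ENNReal.ofReal_inv_of_pos (abs_pos.2 hd)]
  have hx0 : ENNReal.ofReal |cross m n| ≠ 0 := by simpa using hd
  have hxt : ENNReal.ofReal |cross m n| ≠ ∞ := ENNReal.ofReal_ne_top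
  generalize ENNReal.ofReal |cross m n| = x at hx0 hxt
  have hpi : p⁻¹ ≠ ∞ := ENNReal.inv_ne_top.2 (zero_lt_one.trans_le hp).ne'
  have hr : (1 + p⁻¹).toReal = 1 + (p⁻¹).toReal := by
    rw [ENNReal.toReal_add ENNReal.one_ne_top hpi, ENNReal.toReal_one]
  have hs0 : x ^ (p⁻¹).toReal ≠ 0 :=
    (ENNReal.rpow_pos_of_nonneg (pos_iff_ne_zero.2 hx0) ENNReal.toReal_nonneg).ne'
  have hst : x ^ (p⁻¹).toReal ≠ ∞ := ENNReal.rpow_ne_top_of_nonneg ENNReal.toReal_nonneg hxt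
  rw [ENNReal.mul_rpow_of_nonneg _ _ ENNReal.toReal_nonneg]
  have hxr : x ^ (1 + p⁻¹).toReal = x * x ^ (p⁻¹).toReal := by
    rw [hr, ENNReal.rpow_add _ _ hx0 hxt, ENNReal.rpow_one]
  rw [hxr, div_eq_mul_inv, div_eq_mul_inv,
    ENNReal.mul_inv (Or.inl (mul_ne_zero hx0 hs0)) (Or.inl (ENNReal.mul_ne_top hxt hst)),
    ENNReal.mul_inv (Or.inl hx0) (Or.inl hxt)]
  generalize x ^ (p⁻¹).toReal = s at hs0 hst
  calc _ = s * s⁻¹ * (x⁻¹ * (bestError p α β refTriangle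
          (quadForm (quadForm A B C m) (quadForm A B C n) (bilinForm A B C m n))
        * (volume refTriangle ^ (1 + p⁻¹).toReal)⁻¹)) := by ring
    _ = _ := by rw [ENNReal.mul_inv_cancel hs0 hst, one_mul]

/-! ### The extremal ratio -/

lemma quadForm_mul_sub_bilinForm_sq (A B C : ℝ) (m n : Plane) :
    quadForm A B C m * quadForm A B C n - bilinForm A B C m n ^ 2
      = (A * B - C ^ 2) * cross m n ^ 2 := by
  simp only [quadForm, bilinForm, cross]
  ring

/-- The least value of the ratio for the form `quadForm A B C`: the ratio of a triangle on whose
edges the form takes equal values. -/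
def extremalRatio (p α β : ℝ≥0∞) (A B C : ℝ) : ℝ≥0∞ :=
  ENNReal.ofReal √(4 / 3 * (A * B - C ^ 2)) * (bestError p α β refTriangle (quadForm 1 1 (1 / 2))
    / volume refTriangle ^ (1 + p⁻¹).toReal)

lemma extremalRatio_le {A B C : ℝ} (hQ : ∀ z : Plane, z ≠ 0 → 0 < quadForm A B C z)
    (hD : 0 < A * B - C ^ 2) (hp : 1 ≤ p) (T : PlaneTriangle) :
    extremalRatio p α β A B C
      ≤ bestError p α β (region T) (quadForm A B C) / area T ^ (1 + p⁻¹).toReal := by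
  obtain ⟨m, hm⟩ : ∃ m, m = T.points 1 - T.points 0 := ⟨_, rfl⟩
  obtain ⟨n, hn⟩ : ∃ n, n = T.points 2 - T.points 0 := ⟨_, rfl⟩
  have hd : cross m n ≠ 0 := by rw [hm, hn]; exact cross_ne_zero T
  rw [ratio_eq hp A B C T hm hn, extremalRatio]
  have ha : 0 < quadForm A B C m := hQ m fun h => hd (by simp [cross, h])
  have hgram := quadForm_mul_sub_bilinForm_sq A B C m n
  generalize quadForm A B C m = a at *
  generalize quadForm A B C n = b at *
  generalize bilinForm A B C m n = c at *
  have hdpos : 0 < |cross m n| := abs_pos.2 hd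
  have hpos : 0 < a + b - c := by
    have : 0 < (A * B - C ^ 2) * cross m n ^ 2 := by positivity
    -- `a (a + b - c) = (a² - a c + c²) + (a b - c²)`
    refine pos_of_mul_pos_right (a := a) ?_ ha.le
    nlinarith [sq_nonneg (2 * a - c), sq_nonneg c]
  -- Weitzenböck's inequality for the edge values `a`, `b`, `a + b - 2 c`
  have hW : √(4 / 3 * (A * B - C ^ 2)) ≤ |cross m n|⁻¹ * (2 / 3 * (a + b - c)) := by
    refine Real.sqrt_le_iff.2 ⟨by positivity, ?_⟩
    rw [mul_pow, inv_pow, sq_abs, ← div_eq_inv_mul, le_div_iff₀ (by positivity)]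
    nlinarith [sq_nonneg (a - b), sq_nonneg (a - 2 * c), sq_nonneg (b - 2 * c)]
  calc _ ≤ ENNReal.ofReal (|cross m n|⁻¹ * (2 / 3 * (a + b - c)))
        * (bestError p α β refTriangle (quadForm 1 1 (1 / 2))
          / volume refTriangle ^ (1 + p⁻¹).toReal) := by gcongr
    _ = ENNReal.ofReal |cross m n|⁻¹ * (ENNReal.ofReal (2 / 3 * (a + b - c))
        * bestError p α β refTriangle (quadForm 1 1 (1 / 2))
          / volume refTriangle ^ (1 + p⁻¹).toReal) := by
      rw [ENNReal.ofReal_mul (by positivity), mul_assoc, mul_div_assoc]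
    _ ≤ _ := by gcongr; exact le_bestError_refTriangle hp hpos

lemma ratio_eq_extremalRatio {A B C a : ℝ} (ha : 0 < a) (hp : 1 ≤ p) (T : PlaneTriangle)
    {m n : Plane} (hm : m = T.points 1 - T.points 0) (hn : n = T.points 2 - T.points 0)
    (hQm : quadForm A B C m = a) (hQn : quadForm A B C n = a)
    (hB : bilinForm A B C m n = a / 2) :
    bestError p α β (region T) (quadForm A B C) / area T ^ (1 + p⁻¹).toReal
      = extremalRatio p α β A B C := by
  have hd : cross m n ≠ 0 := by rw [hm, hn]; exact cross_ne_zero T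
  have hgram := quadForm_mul_sub_bilinForm_sq A B C m n
  rw [ratio_eq hp A B C T hm hn, extremalRatio]
  rw [hQm, hQn, hB] at *
  have hform : quadForm a a (a / 2) = fun z => a * quadForm 1 1 (1 / 2) z := by
    ext z
    simp only [quadForm]
    ring
  have hs : √(4 / 3 * (A * B - C ^ 2)) = |cross m n|⁻¹ * a := by
    rw [Real.sqrt_eq_iff_mul_self_eq_of_pos (by positivity)]
    have : |cross m n|⁻¹ * a * (|cross m n|⁻¹ * a) = a ^ 2 / cross m n ^ 2 := by
      rw [← sq_abs (cross m n)]; field_simp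
    rw [this, div_eq_iff (by positivity)]
    linarith
  rw [hform, bestError_const_mul ha, hs, ENNReal.ofReal_mul (by positivity), mul_assoc,
    mul_div_assoc]

lemma infRatio_quadForm {A B C : ℝ} (hQ : ∀ z : Plane, z ≠ 0 → 0 < quadForm A B C z)
    (hA : 0 < A) (hD : 0 < A * B - C ^ 2) (hp : 1 ≤ p) :
    infRatio p α β (quadForm A B C) = extremalRatio p α β A B C := by
  refine le_antisymm ?_ (le_iInf fun T => extremalRatio_le hQ hD hp T)
  -- the triangle with vertices `0`, `(1, 0)`, `(1 / 2 - C s / A, s)` has all edge values equal to `A`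
  obtain ⟨s, hs, hs2⟩ : ∃ s : ℝ, 0 < s ∧ s ^ 2 * (A * B - C ^ 2) = 3 / 4 * A ^ 2 :=
    ⟨√(3 / 4 * A ^ 2 / (A * B - C ^ 2)), by positivity, by
      rw [Real.sq_sqrt (by positivity)]; field_simp⟩
  obtain ⟨T, h0, h1, h2⟩ := exists_triangle_of_cross_ne_zero !₂[1, 0] !₂[1 / 2 - C * s / A, s]
    (by simpa [cross] using hs.ne')
  refine (iInf_le _ T).trans_eq (ratio_eq_extremalRatio hA hp T (m := !₂[1, 0])
    (n := !₂[1 / 2 - C * s / A, s]) (by simp [h0, h1]) (by simp [h0, h2]) ?_ ?_ ?_)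
  · simp [quadForm]
  · simp only [quadForm, Matrix.cons_val]
    field_simp
    linear_combination 4 * hs2
  · simp only [bilinForm, Matrix.cons_val]
    field_simp
    ring

lemma quadForm_one_one_zero : quadForm 1 1 0 = sqForm := by
  ext z
  simp [quadForm, sqForm]

lemma extremalRatio_eq_mul (A B C : ℝ) :
    extremalRatio p α β A B C
      = extremalRatio p α β 1 1 0 * ENNReal.ofReal √(A * B - C ^ 2) := by
  rw [extremalRatio, extremalRatio, Real.sqrt_mul (by norm_num), ENNReal.ofReal_mul (by positivity)]
  norm_num
  ring

lemma bestConst_eq (hp : 1 ≤ p) : bestConst p α β = extremalRatio p α β 1 1 0 := by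
  rw [bestConst, ← quadForm_one_one_zero]
  refine infRatio_quadForm (fun z hz => ?_) one_pos (by norm_num) hp
  rw [quadForm_one_one_zero, sqForm]
  by_contra! h
  refine hz ?_
  ext i
  fin_cases i <;> simp <;> nlinarith [sq_nonneg (z 0), sq_nonneg (z 1)]

lemma sqForm_sub (x y : Plane) : sqForm (x - y) = dist x y ^ 2 := by
  rw [EuclideanSpace.dist_sq_eq, Fin.sum_univ_two, sqForm]
  simp [Real.dist_eq, sq_abs]

lemma bestError_equilateral (hp : 1 ≤ p) (T : PlaneTriangle) (hT : T.Equilateral)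
    (harea : area T = 1) : bestError p α β (region T) sqForm = extremalRatio p α β 1 1 0 := by
  obtain ⟨r, hr⟩ := hT
  have h1 : sqForm (T.points 1 - T.points 0) = r ^ 2 := by rw [sqForm_sub, hr _ _ (by decide)]
  have h2 : sqForm (T.points 2 - T.points 0) = r ^ 2 := by rw [sqForm_sub, hr _ _ (by decide)]
  have h3 : sqForm (T.points 1 - T.points 2) = r ^ 2 := by rw [sqForm_sub, hr _ _ (by decide)]
  have hr0 : 0 < r ^ 2 := by
    refine sq_pos_of_ne_zero fun h => ?_
    have := hr 0 1 (by decide)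
    rw [h, dist_eq_zero] at this
    exact absurd (T.independent.injective this) (by decide)
  have h := ratio_eq_extremalRatio (α := α) (β := β) (A := 1) (B := 1) (C := 0) hr0 hp T rfl rfl
    (by rw [quadForm_one_one_zero, h1]) (by rw [quadForm_one_one_zero, h2])
    (by
      simp only [sqForm, bilinForm, PiLp.sub_apply] at h1 h2 h3 ⊢
      linarith)
  rwa [harea, ENNReal.one_rpow, div_one, quadForm_one_one_zero] at h

end AsymApprox
end

theorem corollary4p2
    (A B C : ℝ) (hQ : ∀ z : AsymApprox.Plane, z ≠ 0 → 0 < AsymApprox.quadForm A B C z)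
    (p α β : ℝ≥0∞) (hp : 1 ≤ p) (hα : 0 < α) (hβ : 0 < β) (hαβ : α ≠ ∞ ∨ β ≠ ∞) :
    AsymApprox.infRatio p α β (AsymApprox.quadForm A B C)
        = AsymApprox.bestConst p α β * ENNReal.ofReal (Real.sqrt (A * B - C ^ 2)) ∧
      ∀ T₀ : AsymApprox.PlaneTriangle, T₀.Equilateral → AsymApprox.area T₀ = 1 →
        AsymApprox.bestConst p α β * ENNReal.ofReal (Real.sqrt (A * B - C ^ 2))
          = AsymApprox.bestError p α β (AsymApprox.region T₀) AsymApprox.sqForm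
              * ENNReal.ofReal (Real.sqrt (A * B - C ^ 2)) := by
  have hA : 0 < A := by
    simpa [AsymApprox.quadForm] using hQ !₂[1, 0] fun h => by
      simpa using congrArg (fun z : AsymApprox.Plane => z 0) h
  have hD : 0 < A * B - C ^ 2 := by
    have h := hQ !₂[-C, A] fun h => hA.ne' <| by
      simpa using congrArg (fun z : AsymApprox.Plane => z 1) h
    simp only [AsymApprox.quadForm, Matrix.cons_val] at h
    exact pos_of_mul_pos_right (a := A) (by linarith) hA.le
  rw [AsymApprox.infRatio_quadForm hQ hA hD hp, AsymApprox.bestConst_eq hp]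
  exact ⟨AsymApprox.extremalRatio_eq_mul A B C, fun T₀ hT harea => by
    rw [AsymApprox.bestError_equilateral hp T₀ hT harea]⟩
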